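/- **Setting.** Let $\mathcal X,\mathcal A,\mathcal Y$ be finite sets of states, actions and observations; identify each $y\in\mathcal Y$ with its one-hot vector. An *action-controlled HMM* with transition matrices $T(a)$ ($a\in\mathcal A$), emission matrix $E$ and initial distribution $\pi_0$ consists of states $x_0^\star,x_1^\star,\dots$, actions $a_0,a_1,\dots$ and observations $y_1,y_2,\dots$ on a probability space such that $x_0^\star\sim\pi_0$ and, for every $k\ge 0$, $$\mathbb P(x^\star_{k+1}=i\mid x^\star_{0:k},a_{0:k},y_{1:k})=T(a_k)_{i\,x^\star_k},\qquad \mathbb P(y_{k+1}=s\mid x^\star_{0:k+1},a_{0:k},y_{1:k})=E_{s\,x^\star_{k+1}} .$$ Each action may be randomized and may depend in any way on the past. For every $a\in\mathcal A$ let $P(a)$ be a permutation matrix and let $Q(a)$ satisfy, for each column $j$, with $n_j$ the row of the $1$ in column $j$ of $P(a)$: $Q(a)_{ij}\ge 0$ for $i\ne n_j$ and $Q(a)_{n_jj}=-\sum_{i\neq n_j}Q(a)_{ij}$. Let $E$ be column-stochastic with strictly positive entries and pairwise distinct columns. For all sufficiently small $\varepsilon>0$ consider an action-controlled HMM with transition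 matrices $T_\varepsilon(a)=P(a)+\varepsilon Q(a)$, emission matrix $E$ and initial distribution $\pi_0$ (the rule by which actions are chosen may depend on $\varepsilon$). Given $\delta=\delta_\varepsilon>0$ and a vector $w_0\in\mathbb R^{\mathcal X}$, the time-varying adaptive logit filter (ALF) is $$w_k=P(a_{k-1})(1-\delta)\,w_{k-1}+\delta\log(E^\top y_k),\qquad k\ge1,$$ with the logarithm taken entrywise. Its decoding error is $p_k=\mathbb P[\arg\max_{x}\widehat\alpha_k(x)\ne x_k^\star]$, where $\widehat\alpha_k=\mathrm{softmax}(w_k)$ and a tie for the maximum counts as an error. **Theorem.** 1. If $\delta_\varepsilon\to0$ and $\varepsilon/\delta_\varepsilon\to0$ as $\varepsilon\downarrow0$, then $\displaystyle\lim_{\varepsilon\downarrow0}\limsup_{k\to\infty}p_k=0$. 2. There is a constant $\xi>0$, depending only on $(P(a))_{a\in\mathcal A}$ and $E$, such that for every $\lambda\in(0,\xi)$ the choice $\delta_\varepsilon=\lambda/\log(1/\varepsilon)$ gives $$\limsup_{k\to\infty}p_k\le\kappa\,\varepsilon\log\tfrac1\varepsilon+o\!\left(\varepsilon\log\tfrac1\varepsilon\right)\qquad(\varepsilon\downarrow0),$$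 with a constant $\kappa>0$ that depends only on $(P(a))_a$, $(Q(a))_a$, $E$, $w_0$ and $\lambda$. 3. The long-run error of the Bayes-optimal decoder is dominated by a term of the same order: if $\alpha_k(x)=\mathbb P(x_k^\star=x\mid y_{1:k},a_{0:k-1})$ and $b_k=\mathbb P[\arg\max_x\alpha_k(x)\ne x_k^\star]$ (ties again counting as errors), then $\limsup_{k\to\infty}b_k\le\kappa'\varepsilon\log\frac1\varepsilon+o(\varepsilon\log\frac1\varepsilon)$ as $\varepsilon\downarrow0$, with a constant $\kappa'>0$ that depends only on $(P(a))_a$, $(Q(a))_a$ and $E$. -/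

import Mathlib

open Filter Topology Matrix MeasureTheory Asymptotics

universe u v

/-- A permutation matrix with real entries. -/
def IsPermutationMatrix {X : Type*} [DecidableEq X] (P : Matrix X X ℝ) : Prop :=
  ∃ σ : Equiv.Perm X, P = σ.permMatrix ℝ

/-- `Q` is an admissible drift for the deterministic matrix `D`: in every column `j`, with `n` the
row of the unique `1` of `D` in that column, `Q i j ≥ 0` for `i ≠ n`, and
`Q n j = - ∑_{i ≠ n} Q i j`. -/
def IsDrift {X : Type*} [Fintype X] [DecidableEq X] (D Q : Matrix X X ℝ) : Prop :=
  ∀ j n, D n j = 1 →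
    (∀ i, i ≠ n → 0 ≤ Q i j) ∧ Q n j = -∑ i ∈ Finset.univ.erase n, Q i j

/-- An emission matrix: `E s j` is the probability of observing `s` in state `j`. -/
def IsEmissionMatrix {X Y : Type*} [Fintype Y] (E : Matrix Y X ℝ) : Prop :=
  (∀ s j, 0 ≤ E s j) ∧ ∀ j, ∑ s, E s j = 1

/-- Three discrete-time processes on a probability space: states `x k` and actions `a k` for
`k ≥ 0`, observations `y k` for `k ≥ 1` (the value `y 0` is never used). -/
structure ControlledProcess (X A Y : Type v) where
  Ω : Type u
  mΩ : MeasurableSpace Ω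
  μ : @Measure Ω mΩ
  prob : @IsProbabilityMeasure Ω mΩ μ
  x : ℕ → Ω → X
  a : ℕ → Ω → A
  y : ℕ → Ω → Y
  measurable_x : ∀ k i, @MeasurableSet Ω mΩ {ω | x k ω = i}
  measurable_a : ∀ k b, @MeasurableSet Ω mΩ {ω | a k ω = b}
  measurable_y : ∀ k s, @MeasurableSet Ω mΩ {ω | y k ω = s}

attribute [instance] ControlledProcess.mΩ ControlledProcess.prob

namespace ControlledProcess

variable {X A Y : Type v}

/-- The event that states and actions up to time `k` and observations at times `1, …, k` have
the values prescribed by `ξ`, `α`, `υ`. -/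
def past (H : ControlledProcess.{u} X A Y) (k : ℕ) (ξ : ℕ → X) (α : ℕ → A) (υ : ℕ → Y) :
    Set H.Ω :=
  {ω | (∀ i ≤ k, H.x i ω = ξ i) ∧ (∀ i ≤ k, H.a i ω = α i) ∧
    ∀ i, 1 ≤ i → i ≤ k → H.y i ω = υ i}

/-- The law of an action-controlled hidden Markov model. Given the whole past, including the
current action, the next state has the distribution given by column `x k` of `T (a k)`; given in
addition the next state, the next observation is drawn from the corresponding column of `E`.
Nothing is asked of the actions: each may be randomized and may depend on the whole past. -/
structure IsActionControlledHMM (H : ControlledProcess.{u} X A Y) (T : A → Matrix X X ℝ)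
    (E : Matrix Y X ℝ) (π₀ : X → ℝ) : Prop where
  init : ∀ i, H.μ.real {ω | H.x 0 ω = i} = π₀ i
  transition : ∀ k ξ α υ,
    H.μ.real (H.past k ξ α υ ∩ {ω | H.x (k + 1) ω = ξ (k + 1)}) =
      T (α k) (ξ (k + 1)) (ξ k) * H.μ.real (H.past k ξ α υ)
  emission : ∀ k ξ α υ,
    H.μ.real (H.past k ξ α υ ∩ {ω | H.x (k + 1) ω = ξ (k + 1)} ∩
        {ω | H.y (k + 1) ω = υ (k + 1)}) =
      E (υ (k + 1)) (ξ (k + 1)) *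
        H.μ.real (H.past k ξ α υ ∩ {ω | H.x (k + 1) ω = ξ (k + 1)})

end ControlledProcess

noncomputable section

/-- The one-hot vector of an observation. -/
def oneHot {Y : Type*} [DecidableEq Y] (s : Y) : Y → ℝ := Pi.single s 1

/-- `softmax w = exp w / (𝟙ᵀ exp w)`, entrywise. -/
def softmax {X : Type*} [Fintype X] (w : X → ℝ) : X → ℝ :=
  fun i => Real.exp (w i) / ∑ j, Real.exp (w j)

/-- The set of all maximizers. -/
def argmaxSet {X : Type*} (w : X → ℝ) : Set X := {i | ∀ j, w j ≤ w i}

namespace ControlledProcess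

variable {X A Y : Type v} [Fintype X] [Fintype Y] [DecidableEq Y]

/-- The time-varying adaptive logit filter
`w_{k+1} = P(a_k) (1 - δ) w_k + δ log (Eᵀ y_{k+1})`, started at `w₀`. -/
def alf (H : ControlledProcess.{u} X A Y) (P : A → Matrix X X ℝ) (E : Matrix Y X ℝ)
    (w₀ : X → ℝ) (δ : ℝ) : ℕ → H.Ω → X → ℝ
  | 0, _ => w₀
  | k + 1, ω =>
      P (H.a k ω) *ᵥ ((1 - δ) • H.alf P E w₀ δ k ω) +
        δ • fun i => Real.log ((Eᵀ *ᵥ oneHot (H.y (k + 1) ω)) i)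

/-- The probability `p_k` that the argmax of the proxy belief `softmax (w_k)` is not the true
state; a tie for the maximum counts as an error. -/
def alfError (H : ControlledProcess.{u} X A Y) (P : A → Matrix X X ℝ) (E : Matrix Y X ℝ)
    (w₀ : X → ℝ) (δ : ℝ) (k : ℕ) : ℝ :=
  H.μ.real {ω | argmaxSet (softmax (H.alf P E w₀ δ k ω)) ≠ {H.x k ω}}

end ControlledProcess

namespace ControlledProcess

variable {X A Y : Type v}

/-- The event that the observations `y_1, …, y_k` and the actions `a_0, …, a_{k-1}` are the same
as on `ω`. -/
def observedHistory (H : ControlledProcess.{u} X A Y) (k : ℕ) (ω : H.Ω) : Set H.Ω :=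
  {ω' | (∀ i, 1 ≤ i → i ≤ k → H.y i ω' = H.y i ω) ∧ ∀ i < k, H.a i ω' = H.a i ω}

/-- The belief vector: the conditional distribution of `x_k` given `y_1, …, y_k` and
`a_0, …, a_{k-1}`. -/
def belief (H : ControlledProcess.{u} X A Y) (k : ℕ) (ω : H.Ω) : X → ℝ :=
  fun i => (ProbabilityTheory.cond H.μ (H.observedHistory k ω)).real {ω' | H.x k ω' = i}

/-- The error probability of the Bayes-optimal (maximum a posteriori) decoder; a tie for the
maximum counts as an error. -/
def bayesError (H : ControlledProcess.{u} X A Y) (k : ℕ) : ℝ :=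
  H.μ.real {ω | argmaxSet (H.belief k ω) ≠ {H.x k ω}}

end ControlledProcess

end

/-! Fix a time k and look back over a window of m ≈ c/δ steps. Each step leaves the deterministic
dynamics with probability at most qε, so by a union bound the window contains a jump with
probability at most mqε, which is of order ε/δ.

Without a jump, the gap between the filter value at the true state and at a wrong state obeys g' =
(1-δ)g + δ·(log-likelihood ratio). The potential `∑ exp (-(θ/δ) g)` is scaled so that δ cancels:
averaging over the next observation replaces θ by (1-δ)θ and gains a factor `exp (-2θℓ)`, where `exp
(-ℓ)` bounds the Bhattacharyya coefficients of the columns of E. Iterating from θ = 1/2 sums a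
geometric series, while the filter values at the start of the window are bounded and their influence
shrinks by (1-δ)^m. A suitable c leaves at most |X|·exp(-ℓ/(2δ)), and Markov's inequality turns this
into an error probability (`alfError_le`, `eventually_alfError_le`).

Consistency is then immediate. For δ = λ/log(1/ε) with λ < ℓ/2 the noise term is at most a multiple
of ε, and the jump term has order ε log(1/ε). The Bayes decoder, even with ties counted as errors,
errs at most twice as often as any decoder based on the same observations
(`bayesError_le_two_mul_alfError`). -/

/-! ### Measurability and integration through finite-valued maps. -/

section FiniteValued

variable {Ω ι : Type*} [MeasurableSpace Ω]

/-- A function that factors through a finite-valued map with measurable fibres is measurable. -/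
theorem Function.FactorsThrough.measurable_of_finite [Finite ι] {β : Type*} [MeasurableSpace β]
    {h : Ω → ι} (hh : ∀ c, MeasurableSet (h ⁻¹' {c})) {F : Ω → β}
    (hF : F.FactorsThrough h) : Measurable F := by
  intro s _
  have : F ⁻¹' s = ⋃ c ∈ h '' (F ⁻¹' s), h ⁻¹' {c} := by
    ext ω
    simp only [Set.mem_preimage, Set.mem_iUnion, Set.mem_singleton_iff, exists_prop,
      exists_eq_right', Set.mem_image]
    constructor
    · intro hω
      exact ⟨ω, hω, rfl⟩
    · rintro ⟨ω', hω', e⟩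
      rwa [← hF e]
  rw [this]
  exact MeasurableSet.biUnion (Set.to_countable _) fun c _ => hh c

/-- A function that factors through a finite-valued map with measurable fibres is integrable. -/
theorem Function.FactorsThrough.integrable_of_finite [Finite ι] {μ : Measure Ω} [IsFiniteMeasure μ]
    {h : Ω → ι} (hh : ∀ c, MeasurableSet (h ⁻¹' {c})) {F : Ω → ℝ}
    (hF : F.FactorsThrough h) : Integrable F μ := by
  -- Values of `h` that are not attained get the default 0, so a maximum over the finite type `ι`
  -- bounds `F`.
  obtain ⟨C, hC⟩ := (Set.finite_range fun c => ‖Function.extend h F 0 c‖).bddAbove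
  refine Integrable.of_bound (hF.measurable_of_finite hh).aestronglyMeasurable C
    (Eventually.of_forall fun ω => ?_)
  have := hC (Set.mem_range_self (h ω))
  simpa only [hF.extend_apply] using this

/-- The integral of a function of a finite-valued map. -/
theorem integral_comp_finite [Fintype ι] {μ : Measure Ω} [IsFiniteMeasure μ]
    {h : Ω → ι} (hh : ∀ c, MeasurableSet (h ⁻¹' {c})) (f : ι → ℝ) :
    ∫ ω, f (h ω) ∂μ = ∑ c, μ.real (h ⁻¹' {c}) * f c := by
  classical
  have e : ∀ ω, f (h ω) = ∑ c, (h ⁻¹' {c}).indicator (fun _ => f c) ω := by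
    intro ω
    simp [Set.indicator_apply]
  simp_rw [e]
  rw [integral_finsetSum _ fun c _ => (integrable_const _).indicator (hh c)]
  refine Finset.sum_congr rfl fun c _ => ?_
  rw [integral_indicator_const _ (hh c), smul_eq_mul]

end FiniteValued

/-! ### Separation of the columns of the emission matrix. -/

section Bhattacharyya

variable {X Y : Type*} [Fintype Y] {E : Matrix Y X ℝ}

/-- Two distinct positive probability vectors have Bhattacharyya coefficient less than one. -/
theorem bhattacharyya_lt_one (hE : IsEmissionMatrix E) (hE_pos : ∀ s j, 0 < E s j)
    {i j : X} (hij : E.col i ≠ E.col j) : ∑ s, √(E s i) * √(E s j) < 1 := by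
  obtain ⟨t, ht⟩ : ∃ t, E t i ≠ E t j := by
    by_contra! h
    exact hij (funext h)
  -- AM-GM in each term, strict at the observation `t` where the columns differ.
  have key : ∑ s, √(E s i) * √(E s j) < ∑ s, (E s i + E s j) / 2 := by
    refine Finset.sum_lt_sum (fun s _ => ?_) ⟨t, Finset.mem_univ _, ?_⟩
    · nlinarith [sq_nonneg (√(E s i) - √(E s j)), Real.sq_sqrt (hE_pos s i).le,
        Real.sq_sqrt (hE_pos s j).le]
    · have : √(E t i) - √(E t j) ≠ 0 := by
        rw [sub_ne_zero]
        exact fun h => ht ((Real.sqrt_inj (hE_pos t i).le (hE_pos t j).le).1 h)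
      nlinarith [pow_pos (abs_pos.2 this) 2, sq_abs (√(E t i) - √(E t j)),
        Real.sq_sqrt (hE_pos t i).le, Real.sq_sqrt (hE_pos t j).le]
  rw [← Finset.sum_div, Finset.sum_add_distrib, hE.2, hE.2] at key
  linarith

/-- Exponential moments of the log-likelihood ratio, by Jensen's inequality. -/
theorem sum_exp_neg_logRatio_le (hE : IsEmissionMatrix E) (hE_pos : ∀ s j, 0 < E s j)
    {i j : X} {ℓ θ : ℝ} (hℓ : ∑ s, √(E s i) * √(E s j) ≤ Real.exp (-ℓ))
    (hθ₀ : 0 ≤ θ) (hθ : θ ≤ 1 / 2) :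
    ∑ s, E s i * Real.exp (-θ * (Real.log (E s i) - Real.log (E s j))) ≤
      Real.exp (-(2 * θ * ℓ)) := by
  have hsqrt : ∀ s k, √(E s k) = Real.exp (Real.log (E s k) / 2) := fun s k => by
    rw [← Real.log_sqrt (hE_pos s k).le, Real.exp_log (Real.sqrt_pos.2 (hE_pos s k))]
  -- Concavity of u ↦ u^(2θ), which needs θ ≤ 1/2, at the points u = √(E s j / E s i) with weights
  -- `E s i`; their mean is the Bhattacharyya coefficient.
  have jensen := (Real.concaveOn_rpow (p := 2 * θ) (by linarith) (by linarith)).le_map_sum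
    (t := Finset.univ) (w := fun s => E s i)
    (p := fun s => Real.exp (-(1 / 2) * (Real.log (E s i) - Real.log (E s j))))
    (fun s _ => (hE_pos s i).le) (hE.2 i) (fun s _ => (Real.exp_pos _).le)
  simp only [smul_eq_mul, ← Real.exp_mul] at jensen
  have e₁ : ∀ s, E s i * Real.exp (-(1 / 2) * (Real.log (E s i) - Real.log (E s j))) =
      √(E s i) * √(E s j) := fun s => by
    rw [hsqrt, hsqrt, ← Real.exp_add]
    nth_rewrite 1 [← Real.exp_log (hE_pos s i)]
    rw [← Real.exp_add]
    ring_nf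
  simp only [e₁] at jensen
  calc _ = ∑ s, E s i * Real.exp (-(1 / 2) * (Real.log (E s i) - Real.log (E s j)) * (2 * θ)) := by
        refine Finset.sum_congr rfl fun s _ => ?_
        ring_nf
    _ ≤ _ := jensen
    _ ≤ Real.exp (-ℓ) ^ (2 * θ) := Real.rpow_le_rpow
        (Finset.sum_nonneg fun s _ => by positivity) hℓ (by linarith)
    _ = _ := by
        rw [← Real.exp_mul]
        ring_nf

/-- A uniform separation exponent for an emission matrix with distinct columns. -/
theorem exists_separation_exponent [Finite X] (hE : IsEmissionMatrix E)
    (hE_pos : ∀ s j, 0 < E s j) (hE_col : ∀ i j, i ≠ j → E.col i ≠ E.col j) :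
    ∃ ℓ : ℝ, 0 < ℓ ∧ ∀ i j, i ≠ j → ∑ s, √(E s i) * √(E s j) ≤ Real.exp (-ℓ) := by
  have h : ∀ᶠ ℓ : ℝ in 𝓝[>] 0, ∀ i j, i ≠ j → ∑ s, √(E s i) * √(E s j) ≤ Real.exp (-ℓ) := by
    refine eventually_all.2 fun i => eventually_all.2 fun j => ?_
    by_cases hij : i = j
    · exact Eventually.of_forall fun _ h => (h hij).elim
    · have ht : Tendsto (fun ℓ : ℝ => Real.exp (-ℓ)) (𝓝[>] 0) (𝓝 1) := by
        have : Continuous fun ℓ : ℝ => Real.exp (-ℓ) := by fun_prop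
        simpa using (this.tendsto 0).mono_left nhdsWithin_le_nhds
      filter_upwards [ht.eventually_const_lt (bhattacharyya_lt_one hE hE_pos (hE_col i j hij))]
        with ℓ h _ using h.le
  obtain ⟨ℓ, h₁, h₂⟩ := (h.and self_mem_nhdsWithin).exists
  exact ⟨ℓ, h₂, h₁⟩

end Bhattacharyya

/-! ### Maximizers and ties. -/

section Argmax

variable {X : Type*}

theorem argmaxSet_softmax [Fintype X] (w : X → ℝ) : argmaxSet (softmax w) = argmaxSet w := by
  ext i
  have hpos : 0 < ∑ j, Real.exp (w j) :=
    Finset.sum_pos (fun j _ => Real.exp_pos _) ⟨i, Finset.mem_univ i⟩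
  simp only [argmaxSet, softmax, Set.mem_ofPred_eq, div_le_div_iff_of_pos_right hpos,
    Real.exp_le_exp]

/-- If `x` is not the unique maximizer, some other point has at least the same value. -/
theorem exists_le_of_argmaxSet_ne {w : X → ℝ} {x : X} (h : argmaxSet w ≠ {x}) :
    ∃ z, z ≠ x ∧ w x ≤ w z := by
  by_contra! hlt
  refine h (Set.eq_singleton_iff_unique_mem.2 ⟨fun j => ?_, fun j hj => ?_⟩)
  · by_cases hj : j = x
    · rw [hj]
    · exact (hlt j hj).le
  · by_contra hne
    exact absurd (hj x) (not_le.2 (hlt j hne))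

end Argmax

/-! ### Histories as finite-valued random variables. -/

namespace ControlledProcess

variable {X A Y : Type v} (H : ControlledProcess.{u} X A Y)

/-- The states and actions at times `0, …, k` and the observations at times `1, …, k`. -/
def history (k : ℕ) (ω : H.Ω) : Fin (k + 1) → X × A × Option Y :=
  -- `past` does not constrain `y 0`, so slot 0 must not record it.
  fun i => (H.x i ω, H.a i ω, if (i : ℕ) = 0 then none else some (H.y i ω))

theorem history_eq_iff {k : ℕ} {ω ω' : H.Ω} :
    H.history k ω = H.history k ω' ↔
      ω ∈ H.past k (fun i => H.x i ω') (fun i => H.a i ω') (fun i => H.y i ω') := by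
  simp only [history, past, Set.mem_ofPred_eq, funext_iff, Prod.mk.injEq]
  constructor
  · intro h
    refine ⟨fun i hi => (h ⟨i, by omega⟩).1, fun i hi => (h ⟨i, by omega⟩).2.1,
      fun i h1 hi => ?_⟩
    have := (h ⟨i, by omega⟩).2.2
    simpa [show i ≠ 0 by omega] using this
  · rintro ⟨hx, ha, hy⟩ i
    refine ⟨hx i (by omega), ha i (by omega), ?_⟩
    by_cases hi : (i : ℕ) = 0
    · simp [hi]
    · simp [hi, hy i (by omega) (by omega)]

theorem measurableSet_past (k : ℕ) (ξ : ℕ → X) (α : ℕ → A) (υ : ℕ → Y) :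
    MeasurableSet (H.past k ξ α υ) := by
  have : H.past k ξ α υ = (⋂ i ∈ Set.Iic k, {ω | H.x i ω = ξ i}) ∩
      ((⋂ i ∈ Set.Iic k, {ω | H.a i ω = α i}) ∩ ⋂ i ∈ Set.Icc 1 k, {ω | H.y i ω = υ i}) := by
    ext ω
    simp [past]
  rw [this]
  exact (MeasurableSet.biInter (Set.to_countable _) fun i _ => H.measurable_x i _).inter
    ((MeasurableSet.biInter (Set.to_countable _) fun i _ => H.measurable_a i _).inter
      (MeasurableSet.biInter (Set.to_countable _) fun i _ => H.measurable_y i _))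

theorem preimage_history (k : ℕ) (ω' : H.Ω) :
    H.history k ⁻¹' {H.history k ω'} =
      H.past k (fun i => H.x i ω') (fun i => H.a i ω') (fun i => H.y i ω') :=
  Set.ext fun _ => H.history_eq_iff

theorem measurableSet_preimage_history (k : ℕ) (c : Fin (k + 1) → X × A × Option Y) :
    MeasurableSet (H.history k ⁻¹' {c}) := by
  by_cases h : ∃ ω', H.history k ω' = c
  · obtain ⟨ω', rfl⟩ := h
    rw [preimage_history]
    exact H.measurableSet_past ..
  · convert! MeasurableSet.empty
    exact Set.eq_empty_of_forall_notMem fun ω hω => h ⟨ω, hω⟩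

variable {H}

theorem history_eq_x {k i : ℕ} {ω ω' : H.Ω} (h : H.history k ω = H.history k ω') (hi : i ≤ k) :
    H.x i ω = H.x i ω' := (H.history_eq_iff.1 h).1 i hi

theorem history_eq_a {k i : ℕ} {ω ω' : H.Ω} (h : H.history k ω = H.history k ω') (hi : i ≤ k) :
    H.a i ω = H.a i ω' := (H.history_eq_iff.1 h).2.1 i hi

theorem history_eq_y {k i : ℕ} {ω ω' : H.Ω} (h : H.history k ω = H.history k ω') (h1 : 1 ≤ i)
    (hi : i ≤ k) : H.y i ω = H.y i ω' := (H.history_eq_iff.1 h).2.2 i h1 hi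

/-! ### One-step conditional laws. -/

section Kernel

theorem measurableSet_next (H : ControlledProcess.{u} X A Y) (k : ℕ) (i : X) (s : Y) :
    MeasurableSet {ω | H.x (k + 1) ω = i ∧ H.y (k + 1) ω = s} :=
  (H.measurable_x _ i).inter (H.measurable_y _ s)

variable {T : A → Matrix X X ℝ} {E : Matrix Y X ℝ} {π₀ : X → ℝ}

theorem IsActionControlledHMM.measureReal_next (hH : H.IsActionControlledHMM T E π₀)
    (k : ℕ) (ω' : H.Ω) (i : X) (s : Y) :
    H.μ.real (H.history k ⁻¹' {H.history k ω'} ∩ {ω | H.x (k + 1) ω = i ∧ H.y (k + 1) ω = s}) =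
      E s i * T (H.a k ω') i (H.x k ω') * H.μ.real (H.history k ⁻¹' {H.history k ω'}) := by
  classical
  -- The path of `ω'` is spliced at time `k` with the prescribed next values, so that the transition
  -- and emission laws apply to one pair of sequences.
  let ξ : ℕ → X := fun n => if n ≤ k then H.x n ω' else i
  let υ : ℕ → Y := fun n => if n ≤ k then H.y n ω' else s
  have hpast : H.history k ⁻¹' {H.history k ω'} = H.past k ξ (fun n => H.a n ω') υ := by
    rw [preimage_history]
    ext ω
    simp +contextual [past, ξ, υ]
  have h₁ := hH.transition k ξ (fun n => H.a n ω') υ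
  have h₂ := hH.emission k ξ (fun n => H.a n ω') υ
  have hξ : ξ (k + 1) = i := by simp [ξ]
  have hυ : υ (k + 1) = s := by simp [υ]
  have hξ' : ξ k = H.x k ω' := by simp [ξ]
  rw [hξ, ← hpast] at h₁ h₂
  rw [h₁, hυ, hξ', Set.inter_assoc] at h₂
  rw [mul_assoc, ← h₂]
  rfl

variable [Fintype X] [Fintype A] [Fintype Y]

theorem integrable_of_factorsThrough_history {k : ℕ} {F : H.Ω → ℝ}
    (hF : F.FactorsThrough (H.history k)) : Integrable F H.μ :=
  hF.integrable_of_finite (H.measurableSet_preimage_history k)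

theorem measurableSet_of_factorsThrough_history {k : ℕ} {S : Set H.Ω}
    (hS : ∀ ω ω', H.history k ω = H.history k ω' → (ω ∈ S ↔ ω' ∈ S)) : MeasurableSet S :=
  measurableSet_setOfPred.2 <| Function.FactorsThrough.measurable_of_finite (F := fun ω => ω ∈ S)
    (H.measurableSet_preimage_history k) fun ω ω' h => propext (hS ω ω' h)

/-- Conditional law of the next state and observation given the history, in integrated form. -/
theorem IsActionControlledHMM.setIntegral_next (hH : H.IsActionControlledHMM T E π₀)
    {k : ℕ} {F : H.Ω → ℝ} (hF : F.FactorsThrough (H.history k)) (i : X) (s : Y) :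
    ∫ ω in {ω | H.x (k + 1) ω = i ∧ H.y (k + 1) ω = s}, F ω ∂H.μ =
      ∫ ω, E s i * T (H.a k ω) i (H.x k ω) * F ω ∂H.μ := by
  classical
  have hG : (fun ω => E s i * T (H.a k ω) i (H.x k ω) * F ω).FactorsThrough (H.history k) := by
    intro ω ω' h
    simp only [hF h, history_eq_x h le_rfl, history_eq_a h le_rfl]
  have hh := H.measurableSet_preimage_history k
  -- Both integrands become functions of the history, and the identity is checked on each of its
  -- finitely many values; unattained values have empty fibre.
  obtain ⟨f, rfl⟩ : ∃ f, F = f ∘ H.history k :=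
    ⟨Function.extend (H.history k) F 0, (funext fun ω => hF.extend_apply 0 ω).symm⟩
  obtain ⟨g, hg⟩ : ∃ g : (Fin (k + 1) → X × A × Option Y) → ℝ,
      ∀ ω, E s i * T (H.a k ω) i (H.x k ω) * (f ∘ H.history k) ω =
        g (H.history k ω) :=
    ⟨_, fun ω => (hG.extend_apply 0 ω).symm⟩
  simp_rw [hg, Function.comp_apply]
  rw [integral_comp_finite hh, integral_comp_finite hh]
  refine Finset.sum_congr rfl fun c _ => ?_
  by_cases hc : ∃ ω', H.history k ω' = c
  · obtain ⟨ω', rfl⟩ := hc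
    rw [← hg, measureReal_restrict_apply (hh _), hH.measureReal_next, Function.comp_apply]
    ring
  · have : H.history k ⁻¹' {c} = ∅ :=
      Set.eq_empty_of_forall_notMem fun ω hω => hc ⟨ω, hω⟩
    simp [this]

/-- One-step formula for expectations of functions of the history, the next state and the next
observation. -/
theorem IsActionControlledHMM.integral_next (hH : H.IsActionControlledHMM T E π₀)
    {k : ℕ} {G : H.Ω → X → Y → ℝ} (hG : ∀ i s, (G · i s).FactorsThrough (H.history k)) :
    ∫ ω, G ω (H.x (k + 1) ω) (H.y (k + 1) ω) ∂H.μ =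
      ∫ ω, ∑ i, ∑ s, E s i * T (H.a k ω) i (H.x k ω) * G ω i s ∂H.μ := by
  classical
  have e : ∀ ω, G ω (H.x (k + 1) ω) (H.y (k + 1) ω) =
      ∑ i, ∑ s, {ω | H.x (k + 1) ω = i ∧ H.y (k + 1) ω = s}.indicator (G · i s) ω := by
    intro ω
    simp only [Set.indicator_apply, Set.mem_ofPred_eq, ite_and]
    simp
  have hF : ∀ i s, (fun ω => E s i * T (H.a k ω) i (H.x k ω) * G ω i s).FactorsThrough
      (H.history k) := by
    intro i s ω ω' h
    simp only [hG i s h, history_eq_x h le_rfl, history_eq_a h le_rfl]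
  simp_rw [e]
  have hi : ∀ i s, Integrable
      ({ω | H.x (k + 1) ω = i ∧ H.y (k + 1) ω = s}.indicator (G · i s)) H.μ := fun i s =>
    (integrable_of_factorsThrough_history (hG i s)).indicator (H.measurableSet_next k i s)
  rw [integral_finsetSum _ fun i _ => integrable_finsetSum _ fun s _ => hi i s,
    integral_finsetSum _ fun i _ => integrable_finsetSum _ fun s _ =>
      integrable_of_factorsThrough_history (hF i s)]
  refine Finset.sum_congr rfl fun i _ => ?_
  rw [integral_finsetSum _ fun s _ => hi i s,
    integral_finsetSum _ fun s _ => integrable_of_factorsThrough_history (hF i s)]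
  refine Finset.sum_congr rfl fun s _ => ?_
  rw [integral_indicator (H.measurableSet_next k i s), hH.setIntegral_next (hG i s)]

end Kernel

end ControlledProcess

/-! ### Drift of the exponential potential along jump-free windows. -/

namespace ControlledProcess

variable {X A Y : Type v} [Fintype X] [DecidableEq X] [Fintype Y] [DecidableEq Y]
  {H : ControlledProcess.{u} X A Y} {σ : A → Equiv.Perm X} {E : Matrix Y X ℝ} {w₀ : X → ℝ}
  {δ : ℝ}

/-- `σ.permMatrix` has its 1 of column j in row `σ.symm j`: states move by `σ.symm`, and the filter
reads its old values through `σ`. -/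
theorem alf_succ_apply (k : ℕ) (ω : H.Ω) (i : X) :
    H.alf (fun a => (σ a).permMatrix ℝ) E w₀ δ (k + 1) ω i =
      (1 - δ) * H.alf (fun a => (σ a).permMatrix ℝ) E w₀ δ k ω (σ (H.a k ω) i) +
        δ * Real.log (E (H.y (k + 1) ω) i) := by
  simp [alf, oneHot, PEquiv.toMatrix_toPEquiv_mulVec, Equiv.Perm.permMatrix]

omit [DecidableEq X] in
theorem alf_congr {P : A → Matrix X X ℝ} {k : ℕ} {ω ω' : H.Ω}
    (ha : ∀ i < k, H.a i ω = H.a i ω') (hy : ∀ i, 1 ≤ i → i ≤ k → H.y i ω = H.y i ω') :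
    H.alf P E w₀ δ k ω = H.alf P E w₀ δ k ω' := by
  induction k with
  | zero => rfl
  | succ k ih =>
    simp only [alf]
    rw [ih (fun i hi => ha i (by omega)) (fun i h1 hi => hy i h1 (by omega)), ha k (by omega),
      hy (k + 1) (by omega) le_rfl]

omit [DecidableEq X] in
theorem alf_eq_of_history_eq {P : A → Matrix X X ℝ} {k : ℕ} {ω ω' : H.Ω}
    (h : H.history k ω = H.history k ω') : H.alf P E w₀ δ k ω = H.alf P E w₀ δ k ω' :=
  alf_congr (fun _ hi => history_eq_a h hi.le) fun _ h1 hi => history_eq_y h h1 hi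

/-- Each new entry is a convex combination of an old entry and a log-likelihood, both within `L`. -/
theorem abs_alf_le {L : ℝ} (hδ₀ : 0 ≤ δ) (hδ₁ : δ ≤ 1) (hw : ∀ i, |w₀ i| ≤ L)
    (hL : ∀ s i, |Real.log (E s i)| ≤ L) (k : ℕ) (ω : H.Ω) (i : X) :
    |H.alf (fun a => (σ a).permMatrix ℝ) E w₀ δ k ω i| ≤ L := by
  induction k generalizing i with
  | zero => exact hw i
  | succ k ih =>
    rw [alf_succ_apply]
    refine (abs_add_le _ _).trans ?_
    rw [abs_mul, abs_mul, abs_of_nonneg hδ₀, abs_of_nonneg (sub_nonneg.2 hδ₁)]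
    have h₁ := mul_le_mul_of_nonneg_left (ih (σ (H.a k ω) i)) (sub_nonneg.2 hδ₁)
    have h₂ := mul_le_mul_of_nonneg_left (hL (H.y (k + 1) ω) i) hδ₀
    linarith

variable (H σ) in
/-- The states at times `k₀, …, k₀ + j` follow the deterministic dynamics `σ`. -/
def noJump (k₀ j : ℕ) : Set H.Ω :=
  {ω | ∀ i < j, H.x (k₀ + i + 1) ω = (σ (H.a (k₀ + i) ω)).symm (H.x (k₀ + i) ω)}

omit [Fintype X] [DecidableEq X] [Fintype Y] [DecidableEq Y] in
theorem noJump_succ (k₀ j : ℕ) : H.noJump σ k₀ (j + 1) = H.noJump σ k₀ j ∩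
    {ω | H.x (k₀ + j + 1) ω = (σ (H.a (k₀ + j) ω)).symm (H.x (k₀ + j) ω)} := by
  ext ω
  simp only [noJump, Set.mem_ofPred_eq, Set.mem_inter_iff, Nat.lt_succ_iff_lt_or_eq]
  constructor
  · exact fun h => ⟨fun i hi => h i (Or.inl hi), h j (Or.inr rfl)⟩
  · rintro ⟨h, h'⟩ i (hi | rfl)
    · exact h i hi
    · exact h'

omit [Fintype X] [DecidableEq X] [Fintype Y] [DecidableEq Y] in
theorem mem_noJump_iff_of_history_eq {k₀ j : ℕ} {ω ω' : H.Ω}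
    (h : H.history (k₀ + j) ω = H.history (k₀ + j) ω') :
    ω ∈ H.noJump σ k₀ j ↔ ω' ∈ H.noJump σ k₀ j := by
  simp only [noJump, Set.mem_ofPred_eq]
  refine forall₂_congr fun i hi => ?_
  rw [history_eq_x h (by omega : k₀ + i + 1 ≤ _), history_eq_x h (by omega : k₀ + i ≤ _),
    history_eq_a h (by omega : k₀ + i ≤ _)]

variable (H σ E w₀ δ) in
/-- Sum over the wrong states `z` of `exp (-(θ / δ) (w_k(x_k) - w_k(z)))`. -/
noncomputable def potential (θ : ℝ) (k : ℕ) (ω : H.Ω) : ℝ :=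
  ∑ z ∈ Finset.univ.erase (H.x k ω),
    Real.exp (-(θ / δ) * (H.alf (fun a => (σ a).permMatrix ℝ) E w₀ δ k ω (H.x k ω) -
      H.alf (fun a => (σ a).permMatrix ℝ) E w₀ δ k ω z))

theorem potential_nonneg (θ : ℝ) (k : ℕ) (ω : H.Ω) : 0 ≤ H.potential σ E w₀ δ θ k ω :=
  Finset.sum_nonneg fun _ _ => (Real.exp_pos _).le

theorem potential_eq_of_history_eq {θ : ℝ} {k : ℕ} {ω ω' : H.Ω}
    (h : H.history k ω = H.history k ω') :
    H.potential σ E w₀ δ θ k ω = H.potential σ E w₀ δ θ k ω' := by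
  simp only [potential, alf_eq_of_history_eq h, history_eq_x h le_rfl]

/-- The potential is at least one wherever the filter decodes wrongly. -/
theorem one_le_potential {θ : ℝ} (hθ : 0 ≤ θ) (hδ : 0 ≤ δ) {k : ℕ} {ω : H.Ω}
    (h : argmaxSet (softmax (H.alf (fun a => (σ a).permMatrix ℝ) E w₀ δ k ω)) ≠ {H.x k ω}) :
    1 ≤ H.potential σ E w₀ δ θ k ω := by
  rw [argmaxSet_softmax] at h
  obtain ⟨z, hz, hle⟩ := exists_le_of_argmaxSet_ne h
  refine le_trans ?_ (Finset.single_le_sum (fun _ _ => (Real.exp_pos _).le)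
    (Finset.mem_erase.2 ⟨hz, Finset.mem_univ z⟩))
  rw [Real.one_le_exp_iff]
  have : 0 ≤ θ / δ := div_nonneg hθ hδ
  nlinarith

/-- A crude bound at the start of a window, uniform in time and in the path. -/
theorem potential_le {L θ : ℝ} (hδ₀ : 0 < δ) (hδ₁ : δ ≤ 1) (hθ : 0 ≤ θ)
    (hw : ∀ i, |w₀ i| ≤ L) (hL : ∀ s i, |Real.log (E s i)| ≤ L) (k : ℕ) (ω : H.Ω) :
    H.potential σ E w₀ δ θ k ω ≤ Fintype.card X * Real.exp (θ * (2 * L / δ)) := by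
  calc _ ≤ ∑ z ∈ Finset.univ.erase (H.x k ω), Real.exp (θ * (2 * L / δ)) := by
        refine Finset.sum_le_sum fun z _ => Real.exp_le_exp.2 ?_
        have h₁ := abs_le.1 (abs_alf_le (σ := σ) hδ₀.le hδ₁ hw hL k ω (H.x k ω))
        have h₂ := abs_le.1 (abs_alf_le (σ := σ) hδ₀.le hδ₁ hw hL k ω z)
        have : 0 ≤ θ / δ := by positivity
        calc _ ≤ θ / δ * (2 * L) := by nlinarith
          _ = _ := by ring
    _ ≤ _ := by
        rw [Finset.sum_const, nsmul_eq_mul]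
        gcongr
        exact_mod_cast Finset.card_le_univ _

variable [Fintype A] {T : A → Matrix X X ℝ} {π₀ : X → ℝ}

omit [DecidableEq X] [DecidableEq Y] in
theorem measurableSet_noJump (k₀ j : ℕ) : MeasurableSet (H.noJump σ k₀ j) :=
  measurableSet_of_factorsThrough_history fun _ _ => mem_noJump_iff_of_history_eq

open Classical in
/-- One step of the filter without a jump contracts the expected potential. -/
theorem IsActionControlledHMM.integral_potential_succ_le (hH : H.IsActionControlledHMM T E π₀)
    (hT : ∀ a x, T a ((σ a).symm x) x ≤ 1) (hE : IsEmissionMatrix E)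
    (hE_pos : ∀ s j, 0 < E s j) {ℓ θ : ℝ}
    (hℓ : ∀ i j, i ≠ j → ∑ s, √(E s i) * √(E s j) ≤ Real.exp (-ℓ)) (hδ : 0 < δ)
    (hθ₀ : 0 ≤ θ) (hθ : θ ≤ 1 / 2) (k₀ j : ℕ) :
    ∫ ω in H.noJump σ k₀ (j + 1), H.potential σ E w₀ δ θ (k₀ + j + 1) ω ∂H.μ ≤
      Real.exp (-(2 * θ * ℓ)) *
        ∫ ω in H.noJump σ k₀ j, H.potential σ E w₀ δ ((1 - δ) * θ) (k₀ + j) ω ∂H.μ := by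
  set w := H.alf (fun a => (σ a).permMatrix ℝ) E w₀ δ (k₀ + j) with hw
  -- `c` is the contribution of the old gap, with exponent rescaled by 1-δ. In `G`, the next state
  -- and observation are free variables, as the one-step formula requires; the condition encodes the
  -- absence of a jump.
  let c : H.Ω → X → X → ℝ := fun ω i z =>
    Real.exp (-((1 - δ) * θ / δ) * (w ω (σ (H.a (k₀ + j) ω) i) - w ω (σ (H.a (k₀ + j) ω) z)))
  let G : H.Ω → X → Y → ℝ := fun ω i s =>
    if ω ∈ H.noJump σ k₀ j ∧ i = (σ (H.a (k₀ + j) ω)).symm (H.x (k₀ + j) ω) then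
      ∑ z ∈ Finset.univ.erase i,
        c ω i z * Real.exp (-θ * (Real.log (E s i) - Real.log (E s z))) else 0
  have hG : ∀ i s, (G · i s).FactorsThrough (H.history (k₀ + j)) := by
    intro i s ω ω' h
    simp only [G, c, hw, mem_noJump_iff_of_history_eq h, alf_eq_of_history_eq h,
      history_eq_x h le_rfl, history_eq_a h le_rfl]
  have hleft : ∀ ω, (H.noJump σ k₀ (j + 1)).indicator
      (H.potential σ E w₀ δ θ (k₀ + j + 1)) ω =
        G ω (H.x (k₀ + j + 1) ω) (H.y (k₀ + j + 1) ω) := by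
    intro ω
    simp only [Set.indicator_apply, G, noJump_succ, Set.mem_inter_iff, Set.mem_ofPred_eq]
    refine if_congr Iff.rfl ?_ rfl
    refine Finset.sum_congr rfl fun z _ => ?_
    rw [← Real.exp_add, alf_succ_apply, alf_succ_apply]
    congr 1
    field_simp
    ring
  have hfac : ((H.noJump σ k₀ j).indicator
      (H.potential σ E w₀ δ ((1 - δ) * θ) (k₀ + j))).FactorsThrough (H.history (k₀ + j)) := by
    intro ω ω' h
    simp only [Set.indicator_apply, mem_noJump_iff_of_history_eq h, potential_eq_of_history_eq h]
  rw [← integral_indicator (H.measurableSet_noJump k₀ (j + 1)),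
    ← integral_indicator (H.measurableSet_noJump k₀ j)]
  simp_rw [hleft]
  rw [hH.integral_next hG, ← integral_const_mul]
  refine integral_mono (integrable_of_factorsThrough_history (k := k₀ + j) ?_)
    ((integrable_of_factorsThrough_history hfac).const_mul _) fun ω => ?_
  · intro ω ω' h
    refine Finset.sum_congr rfl fun i _ => Finset.sum_congr rfl fun s _ => ?_
    have := hG i s h
    simp only at this
    rw [this, history_eq_x h le_rfl, history_eq_a h le_rfl]
  by_cases hω : ω ∈ H.noJump σ k₀ j
  swap
  · simp [G, hω]
  set τ := σ (H.a (k₀ + j) ω) with hτ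
  set x := H.x (k₀ + j) ω with hx
  -- Only the deterministic successor survives. Its transition probability factors out, to be
  -- bounded by 1, and the sum over `s` is an exponential moment of the log-likelihood ratio.
  have hsum : ∑ i, ∑ s, E s i * T (H.a (k₀ + j) ω) i x * G ω i s =
      T (H.a (k₀ + j) ω) (τ.symm x) x * ∑ z ∈ Finset.univ.erase (τ.symm x), c ω (τ.symm x) z *
        ∑ s, E s (τ.symm x) *
          Real.exp (-θ * (Real.log (E s (τ.symm x)) - Real.log (E s z))) := by
    rw [Finset.sum_eq_single (τ.symm x) (fun i _ hi => by simp [G, hi, ← hτ, ← hx]) (by simp)]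
    simp only [G, hω, ← hτ, ← hx, and_self, if_true, Finset.mul_sum]
    rw [Finset.sum_comm]
    refine Finset.sum_congr rfl fun z _ => Finset.sum_congr rfl fun s _ => ?_
    ring
  have hpot : H.potential σ E w₀ δ ((1 - δ) * θ) (k₀ + j) ω =
      ∑ z ∈ Finset.univ.erase (τ.symm x), c ω (τ.symm x) z := by
    -- The permutation matches wrong states after the step with wrong states before it.
    refine (Finset.sum_equiv τ (fun z => ?_) fun z _ => ?_).symm
    · simp [Equiv.eq_symm_apply, ← hx]
    · simp [c, ← hτ, ← hw, ← hx]
  simp only [Set.indicator_of_mem hω, hpot]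
  rw [hsum]
  refine (mul_le_of_le_one_left (Finset.sum_nonneg fun z _ => mul_nonneg (Real.exp_pos _).le
    (Finset.sum_nonneg fun s _ => mul_nonneg (hE_pos _ _).le (Real.exp_pos _).le))
    (hT _ _)).trans ?_
  rw [Finset.mul_sum]
  refine Finset.sum_le_sum fun z hz => ?_
  rw [mul_comm]
  exact mul_le_mul_of_nonneg_right (sum_exp_neg_logRatio_le hE hE_pos
    (hℓ _ _ (Finset.ne_of_mem_erase hz).symm) hθ₀ hθ) (Real.exp_pos _).le

/-- Expected potential after `j` steps without a jump. -/
theorem IsActionControlledHMM.integral_potential_le (hH : H.IsActionControlledHMM T E π₀)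
    (hT : ∀ a x, T a ((σ a).symm x) x ≤ 1) (hE : IsEmissionMatrix E)
    (hE_pos : ∀ s j, 0 < E s j) {ℓ L : ℝ}
    (hℓ : ∀ i j, i ≠ j → ∑ s, √(E s i) * √(E s j) ≤ Real.exp (-ℓ)) (hδ₀ : 0 < δ)
    (hδ₁ : δ ≤ 1) (hw : ∀ i, |w₀ i| ≤ L) (hL : ∀ s i, |Real.log (E s i)| ≤ L)
    (k₀ j : ℕ) {θ : ℝ} (hθ₀ : 0 ≤ θ) (hθ : θ ≤ 1 / 2) :
    ∫ ω in H.noJump σ k₀ j, H.potential σ E w₀ δ θ (k₀ + j) ω ∂H.μ ≤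
      Fintype.card X * Real.exp (2 * θ / δ * ((1 - δ) ^ j * L - ℓ * (1 - (1 - δ) ^ j))) := by
  induction j generalizing θ with
  | zero =>
    have hint : Integrable (H.potential σ E w₀ δ θ (k₀ + 0)) H.μ :=
      integrable_of_factorsThrough_history fun _ _ => potential_eq_of_history_eq
    calc _ ≤ ∫ ω, H.potential σ E w₀ δ θ (k₀ + 0) ω ∂H.μ :=
          setIntegral_le_integral hint (Eventually.of_forall fun ω => potential_nonneg ..)
      _ ≤ ∫ _, Fintype.card X * Real.exp (θ * (2 * L / δ)) ∂H.μ :=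
          integral_mono hint (integrable_const _) fun ω => potential_le hδ₀ hδ₁ hθ₀ hw hL _ ω
      _ = _ := by
          rw [integral_const, probReal_univ, one_smul]
          congr 2
          simp only [pow_zero]
          ring
  | succ j ih =>
    refine (hH.integral_potential_succ_le hT hE hE_pos hℓ hδ₀ hθ₀ hθ k₀ j).trans ?_
    -- The exponent shrinks going backwards, hence the induction over all θ. The gains combine
    -- through δ + (1-δ)(1-(1-δ)^j) = 1-(1-δ)^(j+1).
    have h := ih (θ := (1 - δ) * θ) (mul_nonneg (by linarith) hθ₀) (by nlinarith)
    refine (mul_le_mul_of_nonneg_left h (Real.exp_pos _).le).trans (le_of_eq ?_)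
    rw [mul_left_comm, ← Real.exp_add]
    congr 2
    field_simp
    ring

omit [DecidableEq Y] in
theorem IsActionControlledHMM.measureReal_jump_le (hH : H.IsActionControlledHMM T E π₀)
    (hE : IsEmissionMatrix E) {η : ℝ}
    (hη : ∀ a x, ∑ i ∈ Finset.univ.erase ((σ a).symm x), T a i x ≤ η) (k : ℕ) :
    H.μ.real {ω | H.x (k + 1) ω ≠ (σ (H.a k ω)).symm (H.x k ω)} ≤ η := by
  have hm : MeasurableSet {ω | H.x (k + 1) ω ≠ (σ (H.a k ω)).symm (H.x k ω)} :=
    measurableSet_of_factorsThrough_history (k := k + 1) fun ω ω' h => by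
      simp only [Set.mem_ofPred_eq, history_eq_x h le_rfl, history_eq_x h (Nat.le_succ k),
        history_eq_a h (Nat.le_succ k)]
  let G : H.Ω → X → Y → ℝ := fun ω i _ => if i ≠ (σ (H.a k ω)).symm (H.x k ω) then 1 else 0
  have hG : ∀ i s, (G · i s).FactorsThrough (H.history k) := fun i s ω ω' h => by
    simp only [G, history_eq_x h le_rfl, history_eq_a h le_rfl]
  have e : ∀ ω, {ω | H.x (k + 1) ω ≠ (σ (H.a k ω)).symm (H.x k ω)}.indicator 1 ω =
      G ω (H.x (k + 1) ω) (H.y (k + 1) ω) := fun ω => by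
    simp [G, Set.indicator_apply]
  rw [← integral_indicator_one hm]
  simp_rw [e]
  rw [hH.integral_next hG]
  refine (integral_mono (integrable_of_factorsThrough_history (k := k) ?_) (integrable_const η)
    fun ω => ?_).trans_eq (by simp)
  · intro ω ω' h
    simp only [G, history_eq_x h le_rfl, history_eq_a h le_rfl]
  · refine le_trans (le_of_eq ?_) (hη (H.a k ω) (H.x k ω))
    simp only [G, ← Finset.sum_mul, hE.2, one_mul]
    rw [← Finset.filter_ne', Finset.sum_filter]
    refine Finset.sum_congr rfl fun i _ => ?_
    split_ifs <;> simp

-- Union bound over the steps of the window; the bound does not depend on where the window starts.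
omit [DecidableEq Y] in
theorem IsActionControlledHMM.measureReal_compl_noJump_le (hH : H.IsActionControlledHMM T E π₀)
    (hE : IsEmissionMatrix E) {η : ℝ}
    (hη : ∀ a x, ∑ i ∈ Finset.univ.erase ((σ a).symm x), T a i x ≤ η) (k₀ j : ℕ) :
    H.μ.real (H.noJump σ k₀ j)ᶜ ≤ j * η := by
  induction j with
  | zero => simp [noJump]
  | succ j ih =>
    rw [noJump_succ, Set.compl_inter]
    refine (measureReal_union_le _ _).trans ?_
    have := hH.measureReal_jump_le hE hη (k₀ + j)
    push_cast
    rw [add_mul, one_mul]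
    exact add_le_add ih this

/-- Nonasymptotic bound on the decoding error of the filter. -/
theorem IsActionControlledHMM.alfError_le (hH : H.IsActionControlledHMM T E π₀)
    (hT : ∀ a x, T a ((σ a).symm x) x ≤ 1) (hE : IsEmissionMatrix E)
    (hE_pos : ∀ s j, 0 < E s j) {ℓ L η : ℝ}
    (hη : ∀ a x, ∑ i ∈ Finset.univ.erase ((σ a).symm x), T a i x ≤ η)
    (hℓ : ∀ i j, i ≠ j → ∑ s, √(E s i) * √(E s j) ≤ Real.exp (-ℓ)) (hδ₀ : 0 < δ)
    (hδ₁ : δ ≤ 1) (hw : ∀ i, |w₀ i| ≤ L) (hL : ∀ s i, |Real.log (E s i)| ≤ L)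
    (k₀ j : ℕ) :
    H.alfError (fun a => (σ a).permMatrix ℝ) E w₀ δ (k₀ + j) ≤ j * η +
      Fintype.card X * Real.exp (((1 - δ) ^ j * L - ℓ * (1 - (1 - δ) ^ j)) / δ) := by
  set S : Set H.Ω := {ω | argmaxSet (softmax
    (H.alf (fun a => (σ a).permMatrix ℝ) E w₀ δ (k₀ + j) ω)) ≠ {H.x (k₀ + j) ω}} with hS
  have hSm : MeasurableSet S :=
    measurableSet_of_factorsThrough_history (k := k₀ + j) fun ω ω' h => by
      simp only [hS, Set.mem_ofPred_eq, alf_eq_of_history_eq h, history_eq_x h le_rfl]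
  have hint : Integrable (H.potential σ E w₀ δ (1 / 2) (k₀ + j)) H.μ :=
    integrable_of_factorsThrough_history fun _ _ => potential_eq_of_history_eq
  -- Markov's inequality: the potential is at least 1 on the error event.
  have hgood : H.μ.real (S ∩ H.noJump σ k₀ j) ≤
      ∫ ω in H.noJump σ k₀ j, H.potential σ E w₀ δ (1 / 2) (k₀ + j) ω ∂H.μ := by
    rw [← measureReal_restrict_apply hSm, ← integral_indicator_one hSm]
    refine integral_mono ((integrable_const _).indicator hSm) hint.restrict fun ω => ?_
    by_cases hω : ω ∈ S
    · simpa [hω] using one_le_potential (by norm_num) hδ₀.le hω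
    · simpa [hω] using potential_nonneg ..
  -- θ = 1/2 is the largest value that the Jensen bound allows.
  have hbound := hH.integral_potential_le hT hE hE_pos hℓ hδ₀ hδ₁ hw hL k₀ j
    (by norm_num : (0 : ℝ) ≤ 1 / 2) le_rfl
  calc H.μ.real S ≤ H.μ.real ((H.noJump σ k₀ j)ᶜ ∪ S ∩ H.noJump σ k₀ j) :=
        measureReal_mono fun ω hω => by
          by_cases h : ω ∈ H.noJump σ k₀ j
          · exact Or.inr ⟨hω, h⟩
          · exact Or.inl h
    _ ≤ _ := measureReal_union_le _ _
    _ ≤ _ := add_le_add (hH.measureReal_compl_noJump_le hE hη k₀ j) (hgood.trans hbound)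
    _ = _ := by ring_nf

end ControlledProcess

/-! ### Comparison with the Bayes-optimal decoder. -/

namespace ControlledProcess

variable {X A Y : Type v}

/-- The actions `a_0, …, a_{k-1}` and the observations `y_1, …, y_k`. -/
def observations (H : ControlledProcess.{u} X A Y) (k : ℕ) (ω : H.Ω) : Fin k → A × Y :=
  fun i => (H.a i ω, H.y (i + 1) ω)

theorem preimage_observations (H : ControlledProcess.{u} X A Y) (k : ℕ) (ω' : H.Ω) :
    H.observations k ⁻¹' {H.observations k ω'} = H.observedHistory k ω' := by
  ext ω
  simp only [observations, observedHistory, Set.mem_preimage, Set.mem_singleton_iff,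
    Set.mem_ofPred_eq, funext_iff, Prod.mk.injEq]
  constructor
  · intro h
    refine ⟨fun i h1 hi => ?_, fun i hi => (h ⟨i, hi⟩).1⟩
    have := (h ⟨i - 1, by omega⟩).2
    simpa [show i - 1 + 1 = i by omega] using this
  · rintro ⟨hy, ha⟩ i
    exact ⟨ha i i.2, hy _ (by omega) (by omega)⟩

theorem measurableSet_preimage_observations (H : ControlledProcess.{u} X A Y) (k : ℕ)
    (c : Fin k → A × Y) : MeasurableSet (H.observations k ⁻¹' {c}) := by
  have : H.observations k ⁻¹' {c} =
      ⋂ i : Fin k, {ω | H.a i ω = (c i).1} ∩ {ω | H.y (i + 1) ω = (c i).2} := by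
    ext ω
    simp [observations, funext_iff, Prod.ext_iff]
  rw [this]
  exact MeasurableSet.iInter fun i => (H.measurable_a _ _).inter (H.measurable_y _ _)

variable [Fintype X] [Fintype A] [Fintype Y]

/-- On an event `C`, let `α` be the conditional law of a finite-valued `x`. Up to a factor two,
predicting the maximizer of `α`, with ties counted as errors, is at least as good as any fixed
prediction. -/
theorem measureReal_mapError_le {Ω : Type*} [MeasurableSpace Ω] {μ : Measure Ω}
    [IsProbabilityMeasure μ] {C : Set Ω} (hC : MeasurableSet C) {x : Ω → X}
    (hx : ∀ i, MeasurableSet {ω | x ω = i}) (W : Set X) :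
    μ.real ({ω | argmaxSet (fun i => (ProbabilityTheory.cond μ C).real {ω | x ω = i}) ≠ {x ω}} ∩ C)
      ≤ 2 * μ.real ({ω | W ≠ {x ω}} ∩ C) := by
  classical
  set α : X → ℝ := fun i => (ProbabilityTheory.cond μ C).real {ω | x ω = i} with hα
  by_cases hC0 : μ.real C = 0
  · have h0 : μ.real ({ω | argmaxSet α ≠ {x ω}} ∩ C) = 0 :=
      measureReal_mono_null Set.inter_subset_right hC0
    rw [h0]
    positivity
  have hCpos : 0 < μ.real C := lt_of_le_of_ne measureReal_nonneg (Ne.symm hC0)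
  have hαC : ∀ i, μ.real ({ω | x ω = i} ∩ C) = α i * μ.real C := fun i => by
    simp only [hα, measureReal_def, ProbabilityTheory.cond_apply hC, ENNReal.toReal_mul,
      ENNReal.toReal_inv, Set.inter_comm C]
    rw [← measureReal_def, ← measureReal_def]
    field_simp
  have hcompl : ∀ i, μ.real ({ω | x ω ≠ i} ∩ C) = (1 - α i) * μ.real C := fun i => by
    have h₁ := measureReal_sdiff_add_inter (μ := μ) (s := C) (hx i)
    have h₂ : C \ {ω | x ω = i} = {ω | x ω ≠ i} ∩ C := by
      ext ω
      simp [and_comm]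
    rw [h₂, Set.inter_comm C, hαC] at h₁
    linarith
  have hle : ∀ V : Set X, ∀ i, V = {i} →
      μ.real ({ω | V ≠ {x ω}} ∩ C) = (1 - α i) * μ.real C := by
    rintro _ i rfl
    rw [← hcompl i]
    congr 2
    ext ω
    simp [Set.singleton_eq_singleton_iff, eq_comm]
  have hα1 : ∀ i j, i ≠ j → α i + α j ≤ 1 := fun i j hij => by
    have h := hcompl j
    have h' : μ.real ({ω | x ω = i} ∩ C) ≤ μ.real ({ω | x ω ≠ j} ∩ C) :=
      measureReal_mono (Set.inter_subset_inter_left _ fun ω (hω : x ω = i) => by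
        simpa [hω] using hij)
    rw [hαC, h] at h'
    have := le_of_mul_le_mul_right h' hCpos
    linarith
  have hαle : ∀ i, 0 ≤ 1 - α i := fun i =>
    nonneg_of_mul_nonneg_left (hcompl i ▸ measureReal_nonneg) hCpos
  by_cases hW : ∃ i₀, W = {i₀}
  · obtain ⟨i₀, hi₀⟩ := hW
    rw [hle W i₀ hi₀]
    by_cases hV : ∃ i₁, argmaxSet α = {i₁}
    · obtain ⟨i₁, hi₁⟩ := hV
      rw [hle _ i₁ hi₁]
      have hmem : i₁ ∈ argmaxSet α := hi₁ ▸ Set.mem_singleton i₁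
      have := hmem i₀
      nlinarith [hαle i₀]
    -- With a tie, two states share the maximal mass, which is then at most 1/2. Every single guess
    -- errs with conditional probability at least 1/2, which accounts for the factor two.
    · obtain ⟨i₁, -, hi₁⟩ := Finset.exists_max_image Finset.univ α ⟨i₀, Finset.mem_univ i₀⟩
      obtain ⟨i₂, hne, hi₂⟩ := exists_le_of_argmaxSet_ne fun h => hV ⟨i₁, h⟩
      have h₁ := hi₁ i₀ (Finset.mem_univ _)
      have h₂ := hα1 i₂ i₁ hne
      calc _ ≤ μ.real C := measureReal_mono Set.inter_subset_right
        _ ≤ _ := by nlinarith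
  -- A prediction that is not a singleton always counts as an error.
  · have : {ω | W ≠ {x ω}} ∩ C = C := by
      ext ω
      simp only [Set.mem_inter_iff, Set.mem_ofPred_eq, and_iff_right_iff_imp]
      exact fun _ h => hW ⟨_, h⟩
    rw [this]
    have : μ.real ({ω | argmaxSet α ≠ {x ω}} ∩ C) ≤ μ.real C :=
      measureReal_mono Set.inter_subset_right
    linarith

/-- On each observed history both the belief and the filter are constant, so there the filter's
decision is one fixed prediction. -/
theorem bayesError_le_two_mul_alfError [DecidableEq Y] (H : ControlledProcess.{u} X A Y)
    (P : A → Matrix X X ℝ) (E : Matrix Y X ℝ) (w₀ : X → ℝ) (δ : ℝ) (k : ℕ) :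
    H.bayesError k ≤ 2 * H.alfError P E w₀ δ k := by
  classical
  have hh := H.measurableSet_preimage_observations k
  have split : ∀ S : Set H.Ω, H.μ.real S = ∑ c, H.μ.real (S ∩ H.observations k ⁻¹' {c}) := by
    intro S
    have := sum_measureReal_preimage_singleton (μ := H.μ.restrict S) Finset.univ
      (f := H.observations k) fun c _ => hh c
    simp only [Finset.coe_univ, Set.preimage_univ, measureReal_restrict_apply (hh _),
      measureReal_restrict_apply_univ] at this
    rw [← this]
    exact Finset.sum_congr rfl fun c _ => by rw [Set.inter_comm]
  unfold bayesError alfError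
  rw [split, split {ω | argmaxSet (softmax _) ≠ _}, Finset.mul_sum]
  refine Finset.sum_le_sum fun c _ => ?_
  by_cases hc : ∃ ω', H.observations k ω' = c
  · obtain ⟨ω', rfl⟩ := hc
    have hC := hh (H.observations k ω')
    rw [preimage_observations] at hC ⊢
    have key := measureReal_mapError_le (μ := H.μ) hC (H.measurable_x k)
      (argmaxSet (softmax (H.alf P E w₀ δ k ω')))
    convert! key using 2
    · ext ω
      simp only [Set.mem_inter_iff, and_congr_left_iff, Set.mem_ofPred_eq]
      intro hω
      have : H.observedHistory k ω = H.observedHistory k ω' := by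
        rw [← preimage_observations] at hω ⊢
        rw [← preimage_observations, show H.observations k ω = H.observations k ω' from hω]
      unfold belief
      rw [this]
    · congr 1
      ext ω
      simp only [Set.mem_inter_iff, and_congr_left_iff, Set.mem_ofPred_eq]
      intro hω
      rw [alf_congr (ω := ω) (ω' := ω') hω.2 hω.1]
  · have : H.observations k ⁻¹' {c} = ∅ :=
      Set.eq_empty_of_forall_notMem fun ω hω => hc ⟨ω, hω⟩
    simp [this]

end ControlledProcess

/-! ### Jump probabilities under small drift. -/

section Drift

variable {X A : Type*} [DecidableEq X]

theorem permMatrix_symm_apply_self (σ : Equiv.Perm X) (x : X) :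
    σ.permMatrix ℝ (σ.symm x) x = 1 := by
  simp [Equiv.Perm.permMatrix, PEquiv.toMatrix_apply]

theorem permMatrix_apply_of_ne {σ : Equiv.Perm X} {i x : X} (h : i ≠ σ.symm x) :
    σ.permMatrix ℝ i x = 0 := by
  rw [Ne, Equiv.eq_symm_apply] at h
  simp [Equiv.Perm.permMatrix, PEquiv.toMatrix_apply, h]

variable [Fintype X]

/-- The drift only removes mass from the entry 1, since it sends nonnegative mass to the other rows.
-/
theorem IsDrift.apply_le_one {σ : Equiv.Perm X} {Q : Matrix X X ℝ}
    (hQ : IsDrift (σ.permMatrix ℝ) Q) {ε : ℝ} (hε : 0 ≤ ε) (x : X) :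
    (σ.permMatrix ℝ + ε • Q) (σ.symm x) x ≤ 1 := by
  obtain ⟨h₁, h₂⟩ := hQ x _ (permMatrix_symm_apply_self σ x)
  have : 0 ≤ ∑ i ∈ Finset.univ.erase (σ.symm x), Q i x :=
    Finset.sum_nonneg fun i hi => h₁ i (Finset.ne_of_mem_erase hi)
  rw [Matrix.add_apply, permMatrix_symm_apply_self, Matrix.smul_apply, h₂, smul_eq_mul]
  nlinarith

/-- Under small drift the probability of leaving the deterministic dynamics is of order `ε`. -/
theorem sum_erase_permMatrix_add_smul_le [Fintype A] (σ : A → Equiv.Perm X)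
    (Q : A → Matrix X X ℝ) {ε : ℝ} (hε : 0 ≤ ε) (a : A) (x : X) :
    ∑ i ∈ Finset.univ.erase ((σ a).symm x), ((σ a).permMatrix ℝ + ε • Q a) i x ≤
      (∑ a, ∑ x, ∑ i, |Q a i x|) * ε := by
  calc _ ≤ ∑ i ∈ Finset.univ.erase ((σ a).symm x), ε * |Q a i x| := by
        refine Finset.sum_le_sum fun i hi => ?_
        rw [Matrix.add_apply, permMatrix_apply_of_ne (Finset.ne_of_mem_erase hi), zero_add,
          Matrix.smul_apply, smul_eq_mul]
        exact mul_le_mul_of_nonneg_left (le_abs_self _) hε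
    _ ≤ ∑ i, ε * |Q a i x| := Finset.sum_le_sum_of_subset_of_nonneg (Finset.subset_univ _)
        fun _ _ _ => by positivity
    _ = (∑ i, |Q a i x|) * ε := by rw [← Finset.mul_sum, mul_comm]
    _ ≤ _ := by
        refine mul_le_mul_of_nonneg_right ?_ hε
        refine (Finset.single_le_sum (f := fun x => ∑ i, |Q a i x|) (fun x _ => ?_)
          (Finset.mem_univ x)).trans
          (Finset.single_le_sum (f := fun a => ∑ x, ∑ i, |Q a i x|) (fun a _ => ?_)
            (Finset.mem_univ a)) <;> positivity

end Drift

/-! ### Long-run error bounds and asymptotics as ε ↓ 0. -/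

theorem tendsto_log_one_div : Tendsto (fun ε : ℝ => Real.log (1 / ε)) (𝓝[>] 0) atTop := by
  simpa only [one_div, Function.comp_def] using
    Real.tendsto_log_atTop.comp (tendsto_inv_nhdsGT_zero (𝕜 := ℝ))

theorem isLittleO_const_mul_self (C : ℝ) :
    (fun ε : ℝ => C * ε) =o[𝓝[>] 0] (fun ε => ε * Real.log (1 / ε)) := by
  have h : (fun _ : ℝ => C) =o[𝓝[>] 0] fun ε => Real.log (1 / ε) :=
    isLittleO_const_left.2 (Or.inr (tendsto_norm_atTop_atTop.comp tendsto_log_one_div))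
  simpa only [mul_comm] using h.mul_isBigO (isBigO_refl (fun ε : ℝ => ε) _)

namespace ControlledProcess

variable {X A Y : Type v} [Fintype X] [Fintype Y] [DecidableEq Y]

theorem limsup_alfError_le {H : ControlledProcess.{u} X A Y} {P : A → Matrix X X ℝ}
    {E : Matrix Y X ℝ} {w₀ : X → ℝ} {δ b : ℝ}
    (h : ∀ᶠ k in atTop, H.alfError P E w₀ δ k ≤ b) :
    limsup (H.alfError P E w₀ δ) atTop ≤ b :=
  limsup_le_of_le (isCoboundedUnder_le_of_le _ (x := 0) fun _ => measureReal_nonneg) h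

theorem limsup_alfError_nonneg (H : ControlledProcess.{u} X A Y) (P : A → Matrix X X ℝ)
    (E : Matrix Y X ℝ) (w₀ : X → ℝ) (δ : ℝ) :
    0 ≤ limsup (H.alfError P E w₀ δ) atTop :=
  le_limsup_of_frequently_le (Frequently.of_forall fun _ => measureReal_nonneg)
    (isBoundedUnder_of_eventually_le (a := 1) (Eventually.of_forall fun _ => measureReal_le_one))

variable [DecidableEq X] [Fintype A]

/-- Long-run error of the filter: a term of order `ε / δ` from the jumps of the state and a term
exponentially small in `1 / δ` from the observation noise. -/
theorem eventually_alfError_le {σ : A → Equiv.Perm X} {E : Matrix Y X ℝ}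
    (hE : IsEmissionMatrix E) (hE_pos : ∀ s j, 0 < E s j) {ℓ : ℝ} (hℓ₀ : 0 < ℓ)
    (hℓ : ∀ i j, i ≠ j → ∑ s, √(E s i) * √(E s j) ≤ Real.exp (-ℓ)) (w₀ : X → ℝ) :
    ∃ c : ℝ, 0 ≤ c ∧ ∀ Q : A → Matrix X X ℝ, (∀ a, IsDrift ((σ a).permMatrix ℝ) (Q a)) →
      ∀ (π₀ : X → ℝ) (H : ControlledProcess.{u} X A Y) (ε δ : ℝ), 0 ≤ ε → 0 < δ → δ ≤ 1 →
        H.IsActionControlledHMM (fun a => (σ a).permMatrix ℝ + ε • Q a) E π₀ →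
        ∀ᶠ k in atTop, H.alfError (fun a => (σ a).permMatrix ℝ) E w₀ δ k ≤
          (c / δ + 1) * ((∑ a, ∑ x, ∑ i, |Q a i x|) * ε) +
            Fintype.card X * Real.exp (-(ℓ / 2 / δ)) := by
  obtain ⟨L₁, hL₁⟩ := (Set.finite_range fun i => |w₀ i|).bddAbove
  obtain ⟨L₂, hL₂⟩ := (Set.finite_range fun p : Y × X => |Real.log (E p.1 p.2)|).bddAbove
  -- The 0 ensures `0 ≤ L` also when `X` is empty.
  set L := max (max L₁ L₂) 0
  have hw : ∀ i, |w₀ i| ≤ L := fun i =>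
    (hL₁ (Set.mem_range_self i)).trans ((le_max_left _ _).trans (le_max_left _ _))
  have hL : ∀ s i, |Real.log (E s i)| ≤ L := fun s i =>
    (hL₂ (Set.mem_range_self (s, i))).trans ((le_max_right _ _).trans (le_max_left _ _))
  have hL0 : 0 ≤ L := le_max_right _ _
  -- `c` is the window length in units of 1/δ. It makes the remaining influence of the start cost at
  -- most half of the gain ℓ, and it is fixed before `Q`, ε and δ.
  obtain ⟨c, hc₀, hc⟩ : ∃ c : ℝ, 0 ≤ c ∧ Real.exp (-c) * (L + ℓ) ≤ ℓ / 2 := by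
    have ht : Tendsto (fun c : ℝ => Real.exp (-c) * (L + ℓ)) atTop (𝓝 (0 * (L + ℓ))) :=
      (Real.tendsto_exp_neg_atTop_nhds_zero).mul_const _
    rw [zero_mul] at ht
    obtain ⟨c, h₁, h₂⟩ := ((ht.eventually_lt_const (half_pos hℓ₀)).and
      (eventually_ge_atTop 0)).exists
    exact ⟨c, h₂, h₁.le⟩
  refine ⟨c, hc₀, fun Q hQ π₀ H ε δ hε hδ₀ hδ₁ hH => ?_⟩
  set m := ⌈c / δ⌉₊
  have hm₁ : c / δ ≤ m := Nat.le_ceil _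
  have hm₂ : (m : ℝ) ≤ c / δ + 1 := (Nat.ceil_lt_add_one (by positivity)).le
  have hpow : (1 - δ) ^ m ≤ Real.exp (-c) := by
    calc (1 - δ) ^ m ≤ Real.exp (-δ) ^ m :=
          pow_le_pow_left₀ (by linarith) (Real.one_sub_le_exp_neg δ) m
      _ = Real.exp (-(m * δ)) := by rw [← Real.exp_nat_mul]; ring_nf
      _ ≤ _ := Real.exp_le_exp.2 (neg_le_neg ((div_le_iff₀ hδ₀).1 hm₁))
  have hexp : ((1 - δ) ^ m * L - ℓ * (1 - (1 - δ) ^ m)) / δ ≤ -(ℓ / 2 / δ) := by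
    rw [← neg_div]
    refine div_le_div_of_nonneg_right ?_ hδ₀.le
    have := mul_le_mul_of_nonneg_right hpow (by linarith : 0 ≤ L + ℓ)
    linarith
  filter_upwards [eventually_ge_atTop m] with k hk
  -- The window of `m` steps ends at the current time and starts at `k₀`.
  obtain ⟨k₀, rfl⟩ := Nat.exists_eq_add_of_le' hk
  refine (hH.alfError_le (fun a x => (hQ a).apply_le_one hε x) hE hE_pos
    (sum_erase_permMatrix_add_smul_le σ Q hε) hℓ hδ₀ hδ₁ hw hL k₀ m).trans ?_
  have hq : 0 ≤ ∑ a, ∑ x, ∑ i, |Q a i x| := by positivity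
  gcongr

/-- With `δ = lam / log (1 / ε)` and `lam` small the error is of order `ε log (1 / ε)`. -/
theorem eventually_alfError_rate {σ : A → Equiv.Perm X} {E : Matrix Y X ℝ}
    (hE : IsEmissionMatrix E) (hE_pos : ∀ s j, 0 < E s j) {ℓ : ℝ} (hℓ₀ : 0 < ℓ)
    (hℓ : ∀ i j, i ≠ j → ∑ s, √(E s i) * √(E s j) ≤ Real.exp (-ℓ))
    {Q : A → Matrix X X ℝ} (hQ : ∀ a, IsDrift ((σ a).permMatrix ℝ) (Q a)) (w₀ : X → ℝ)
    {lam : ℝ} (hlam₀ : 0 < lam) (hlam : lam < ℓ / 2) :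
    ∃ κ C : ℝ, 0 < κ ∧ ∀ (π₀ : X → ℝ) (H : ℝ → ControlledProcess.{u} X A Y),
      (∀ᶠ ε in 𝓝[>] (0 : ℝ),
        (H ε).IsActionControlledHMM (fun a => (σ a).permMatrix ℝ + ε • Q a) E π₀) →
      ∀ᶠ ε in 𝓝[>] (0 : ℝ), ∀ᶠ k in atTop,
        (H ε).alfError (fun a => (σ a).permMatrix ℝ) E w₀ (lam / Real.log (1 / ε)) k ≤
          κ * (ε * Real.log (1 / ε)) + C * ε := by
  obtain ⟨c, hc₀, hc⟩ := eventually_alfError_le.{u} (σ := σ) hE hE_pos hℓ₀ hℓ w₀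
  set q := ∑ a, ∑ x, ∑ i, |Q a i x|
  have hq : 0 ≤ q := by positivity
  -- The +1 only makes κ positive. In the coefficient of ε, `q` comes from rounding the window
  -- length up and the cardinality from the noise term.
  refine ⟨c * q / lam + 1, q + Fintype.card X, by positivity, fun π₀ H hH => ?_⟩
  filter_upwards [hH, self_mem_nhdsWithin,
    tendsto_log_one_div.eventually_ge_atTop (max lam 1)] with ε hε (hpos : 0 < ε) hlog
  have hlog₁ : 1 ≤ Real.log (1 / ε) := (le_max_right _ _).trans hlog
  have hlog₀ : 0 < Real.log (1 / ε) := by linarith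
  have hδ₁ : lam / Real.log (1 / ε) ≤ 1 :=
    (div_le_one hlog₀).2 ((le_max_left _ _).trans hlog)
  filter_upwards [hc Q hQ π₀ (H ε) ε _ hpos.le (div_pos hlam₀ hlog₀) hδ₁ hε] with k hk
  -- The left side is ε^(ℓ/(2λ)), with exponent above 1 because λ < ℓ/2.
  have hexp : Real.exp (-(ℓ / 2 / (lam / Real.log (1 / ε)))) ≤ ε := by
    calc _ ≤ Real.exp (-Real.log (1 / ε)) := by
          refine Real.exp_le_exp.2 (neg_le_neg ?_)
          rw [div_div_eq_mul_div, le_div_iff₀ hlam₀, mul_comm]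
          exact mul_le_mul_of_nonneg_right hlam.le hlog₀.le
      _ = ε := by rw [one_div, Real.log_inv, neg_neg, Real.exp_log hpos]
  refine hk.trans ?_
  have h₁ : c / (lam / Real.log (1 / ε)) * (q * ε) = c * q / lam * (ε * Real.log (1 / ε)) := by
    field_simp
  have h₂ : (Fintype.card X : ℝ) * Real.exp (-(ℓ / 2 / (lam / Real.log (1 / ε)))) ≤
      Fintype.card X * ε := by gcongr
  have h₃ : 0 < ε * Real.log (1 / ε) := by positivity
  rw [add_mul, h₁]
  linarith

end ControlledProcess

/-! ### Consistency, rate and Bayes error. -/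

theorem theorem3 {X A Y : Type v} [Fintype X] [DecidableEq X] [Fintype A]
    [Fintype Y] [DecidableEq Y]
    (P : A → Matrix X X ℝ) (hP : ∀ a, IsPermutationMatrix (P a))
    (E : Matrix Y X ℝ) (hE : IsEmissionMatrix E) (hE_pos : ∀ s j, 0 < E s j)
    (hE_col : ∀ i j, i ≠ j → E.col i ≠ E.col j) :
    -- consistency
    (∀ Q : A → Matrix X X ℝ, (∀ a, IsDrift (P a) (Q a)) →
      ∀ (w₀ π₀ : X → ℝ) (H : ℝ → ControlledProcess.{u} X A Y),
        (∀ᶠ ε in 𝓝[>] (0 : ℝ), (H ε).IsActionControlledHMM (fun a => P a + ε • Q a) E π₀) →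
      ∀ δ : ℝ → ℝ, (∀ᶠ ε in 𝓝[>] (0 : ℝ), 0 < δ ε) →
        Tendsto δ (𝓝[>] 0) (𝓝 0) → Tendsto (fun ε => ε / δ ε) (𝓝[>] 0) (𝓝 0) →
        Tendsto (fun ε => limsup (fun k => (H ε).alfError P E w₀ (δ ε) k) atTop)
          (𝓝[>] 0) (𝓝 0)) ∧
    -- rate, with a threshold `ξ` that depends only on `P` and `E`
    (∃ ξ : ℝ, 0 < ξ ∧
      ∀ Q : A → Matrix X X ℝ, (∀ a, IsDrift (P a) (Q a)) →
      ∀ (w₀ : X → ℝ) (lam : ℝ), 0 < lam → lam < ξ →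
      ∃ κ : ℝ, 0 < κ ∧
        ∀ (π₀ : X → ℝ) (H : ℝ → ControlledProcess.{u} X A Y),
          (∀ᶠ ε in 𝓝[>] (0 : ℝ), (H ε).IsActionControlledHMM (fun a => P a + ε • Q a) E π₀) →
          ∃ r : ℝ → ℝ, r =o[𝓝[>] 0] (fun ε => ε * Real.log (1 / ε)) ∧
            ∀ᶠ ε in 𝓝[>] (0 : ℝ),
              limsup (fun k => (H ε).alfError P E w₀ (lam / Real.log (1 / ε)) k) atTop ≤
                κ * (ε * Real.log (1 / ε)) + r ε) ∧
    -- the long-run error of the Bayes-optimal decoder is dominated by a term of the same order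
    (∀ Q : A → Matrix X X ℝ, (∀ a, IsDrift (P a) (Q a)) →
      ∃ κ : ℝ, 0 < κ ∧
        ∀ (π₀ : X → ℝ) (H : ℝ → ControlledProcess.{u} X A Y),
          (∀ᶠ ε in 𝓝[>] (0 : ℝ), (H ε).IsActionControlledHMM (fun a => P a + ε • Q a) E π₀) →
          ∃ r : ℝ → ℝ, r =o[𝓝[>] 0] (fun ε => ε * Real.log (1 / ε)) ∧
            ∀ᶠ ε in 𝓝[>] (0 : ℝ),
              limsup (fun k => (H ε).bayesError k) atTop ≤
                κ * (ε * Real.log (1 / ε)) + r ε) := by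

  choose σ hσ using hP
  obtain rfl : P = fun a => (σ a).permMatrix ℝ := funext hσ
  obtain ⟨ℓ, hℓ₀, hℓ⟩ := exists_separation_exponent hE hE_pos hE_col
  -- The threshold is ℓ/2, where ℓ was obtained from `E` alone.
  refine ⟨?_, ⟨ℓ / 2, by positivity, ?_⟩, ?_⟩
  · intro Q hQ w₀ π₀ H hH δ hδ hδ₀ hεδ
    obtain ⟨c, hc₀, hc⟩ := ControlledProcess.eventually_alfError_le.{u} (σ := σ) hE hE_pos hℓ₀ hℓ w₀
    set q := ∑ a, ∑ x, ∑ i, |Q a i x|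
    have hδ' : Tendsto δ (𝓝[>] 0) (𝓝[>] 0) := tendsto_nhdsWithin_iff.2 ⟨hδ₀, hδ⟩
    have hid : Tendsto (fun ε : ℝ => ε) (𝓝[>] 0) (𝓝 0) := nhdsWithin_le_nhds
    have hexp : Tendsto (fun ε => Real.exp (-(ℓ / 2 / δ ε))) (𝓝[>] 0) (𝓝 0) := by
      refine Real.tendsto_exp_neg_atTop_nhds_zero.comp ?_
      simpa only [div_eq_mul_inv, Function.comp_def] using
        (tendsto_inv_nhdsGT_zero.comp hδ').const_mul_atTop (half_pos hℓ₀)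
    have hlim : Tendsto (fun ε => c * q * (ε / δ ε) + q * ε +
        Fintype.card X * Real.exp (-(ℓ / 2 / δ ε))) (𝓝[>] 0) (𝓝 0) := by
      simpa using ((hεδ.const_mul (c * q)).add (hid.const_mul q)).add
        (hexp.const_mul (Fintype.card X : ℝ))
    refine tendsto_of_tendsto_of_tendsto_of_le_of_le' tendsto_const_nhds hlim
      (Eventually.of_forall fun ε => ControlledProcess.limsup_alfError_nonneg ..) ?_
    filter_upwards [hH, hδ, self_mem_nhdsWithin, hδ₀.eventually_le_const one_pos]
      with ε hε hδε (hpos : 0 < ε) hδ1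
    refine (ControlledProcess.limsup_alfError_le
      (hc Q hQ π₀ (H ε) ε (δ ε) hpos.le hδε hδ1 hε)).trans (le_of_eq ?_)
    ring
  · intro Q hQ w₀ lam hlam₀ hlam
    obtain ⟨κ, C, hκ, h⟩ :=
      ControlledProcess.eventually_alfError_rate.{u} hE hE_pos hℓ₀ hℓ hQ w₀ hlam₀ hlam
    refine ⟨κ, hκ, fun π₀ H hH => ⟨fun ε => C * ε, isLittleO_const_mul_self C, ?_⟩⟩
    filter_upwards [h π₀ H hH] with ε hε using ControlledProcess.limsup_alfError_le hε
  · intro Q hQ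
    -- The Bayes error involves no filter, so any initial vector and any λ in (0, ℓ/2) serve for the
    -- comparison; fixing them keeps the constant free of both.
    obtain ⟨κ, C, hκ, h⟩ := ControlledProcess.eventually_alfError_rate.{u} hE hE_pos hℓ₀ hℓ hQ 0
      (lam := ℓ / 4) (by positivity) (by linarith)
    refine ⟨2 * κ, by positivity, fun π₀ H hH =>
      ⟨fun ε => 2 * C * ε, isLittleO_const_mul_self _, ?_⟩⟩
    filter_upwards [h π₀ H hH] with ε hε
    refine limsup_le_of_le (isCoboundedUnder_le_of_le _ (x := 0) fun _ => measureReal_nonneg) ?_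
    filter_upwards [hε] with k hk
    have := (H ε).bayesError_le_two_mul_alfError (fun a => (σ a).permMatrix ℝ) E 0
      (ℓ / 4 / Real.log (1 / ε)) k
    linarith
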